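/- Let $S$ be a locally compact metrizable topological space and let $L$ be a locally compact Hausdorff space. Let $C_0(S)$ and $C_0(L)$ be the real Banach spaces of real-valued continuous functions vanishing at infinity on $S$ and on $L$, with the supremum norm. Then the pair $(C_0(S), C_0(L))$ has the Bishop–Phelps–Bollobás property for operators: for every $\varepsilon\in(0,1)$ there is $\eta(\varepsilon)>0$ such that for every bounded linear operator $T\colon C_0(S)\to C_0(L)$ with $\|T\|=1$ and every $f_0\in C_0(S)$ with $\|f_0\|=1$ and $\|T f_0\|>1-\eta(\varepsilon)$, there exist a bounded linear operator $R\colon C_0(S)\to C_0(L)$ and $f\in C_0(S)$ with $\|f\|=1$ such that $$1=\|R\|=\|R f\|,\qquad \|f_0-f\|<\varepsilon\qquad\text{and}\qquad \|T-R\|<\varepsilon.$$ -/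

import Mathlib

open scoped ZeroAtInfty

/-- The Bishop–Phelps–Bollobás property for operators of a pair `(X, Y)` of Banach spaces over `𝕜`:
for every `ε ∈ (0, 1)` there is `η > 0` such that whenever `T` is a bounded operator of norm one
and `x₀` is a unit vector with `‖T x₀‖ > 1 - η`, there are a bounded operator `S` of norm one and a
unit vector `x` at which `S` attains its norm, with `‖x₀ - x‖ < ε` and `‖T - S‖ < ε`. -/
def HasBPBp (𝕜 X Y : Type*) [RCLike 𝕜]
    [NormedAddCommGroup X] [NormedSpace 𝕜 X] [CompleteSpace X]
    [NormedAddCommGroup Y] [NormedSpace 𝕜 Y] [CompleteSpace Y] : Prop :=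
  ∀ ε : ℝ, 0 < ε → ε < 1 → ∃ η : ℝ, 0 < η ∧
    ∀ (T : X →L[𝕜] Y) (x₀ : X), ‖T‖ = 1 → ‖x₀‖ = 1 → 1 - η < ‖T x₀‖ →
      ∃ (S : X →L[𝕜] Y) (x : X), ‖x‖ = 1 ∧ ‖S‖ = 1 ∧ ‖S x‖ = 1 ∧ ‖x₀ - x‖ < ε ∧ ‖T - S‖ < ε

namespace ZeroAtInftyContinuousMap

section Norm

variable {X : Type*} [TopologicalSpace X]

/-! Exact attainment follows from approximate attainment: if `T` and `f₀` can be moved by at most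
`ε` so that the norm is attained up to any prescribed `γ`, iterating with summable errors gives the
theorem in the limit. For one such move, truncate `f₀` to an `f` equal to `±1` where `|f₀|` is
nearly `1`, so that `T` keeps almost all its mass there. The norm of `u ↦ T u s` is only lower
semicontinuous in `s`, so rescaling at one point could break the norm bound nearby. `exists_weight`
supplies a weight `w` for which the functionals `u ↦ T (w * u) s` have norm at most `T (w * f) t +
δ` for all `s` near `t`. There, a bump function blends `T` with a multiple of `u ↦ T (w * u)`. -/

lemma abs_apply_le_norm (f : C₀(X, ℝ)) (x : X) : |f x| ≤ ‖f‖ := by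
  have h := f.toBCF.norm_coe_le_norm x
  rwa [norm_toBCF_eq_norm] at h

lemma norm_le_iff {f : C₀(X, ℝ)} {C : ℝ} (hC : 0 ≤ C) : ‖f‖ ≤ C ↔ ∀ x, |f x| ≤ C := by
  rw [← norm_toBCF_eq_norm, BoundedContinuousFunction.norm_le hC]
  rfl

/-- Postcomposition of a function vanishing at infinity with a continuous function fixing `0`. -/
def postcomp (c : ℝ → ℝ) (hc : Continuous c) (h0 : c 0 = 0) (f : C₀(X, ℝ)) : C₀(X, ℝ) where
  toFun x := c (f x)
  continuous_toFun := hc.comp (map_continuous f)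
  zero_at_infty' := by
    have h : Filter.Tendsto c (nhds 0) (nhds 0) := by simpa [h0] using hc.tendsto 0
    exact h.comp (zero_at_infty f)

@[simp] lemma postcomp_apply (c : ℝ → ℝ) (hc : Continuous c) (h0 : c 0 = 0) (f : C₀(X, ℝ))
    (x : X) : postcomp c hc h0 f x = c (f x) := rfl

/-- A locally compact Hausdorff space carries bump functions vanishing at infinity. -/
lemma exists_bump [LocallyCompactSpace X] [T2Space X] {U : Set X} (hU : IsOpen U) {t : X}
    (ht : t ∈ U) :
    ∃ h : C₀(X, ℝ), h t = 1 ∧ (∀ s ∉ U, h s = 0) ∧ ∀ s, 0 ≤ h s ∧ h s ≤ 1 := by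
  obtain ⟨h, h1, h0, hc, hI⟩ := exists_continuous_one_zero_of_isCompact
    (isCompact_singleton (x := t)) hU.isClosed_compl (by simpa using ht)
  exact ⟨⟨h, hc.is_zero_at_infty⟩, h1 rfl, fun s hs => h0 hs, fun s => hI s⟩

end Norm

/-- The truncation at height `1 - ε`, rescaled to `[-1, 1]`. -/
noncomputable def clamp (ε a : ℝ) : ℝ := max (-1) (min 1 (a / (1 - ε)))

/-- A cutoff function that vanishes where `|a| ≤ 1 - ε` and equals `1` where `|a| = 1`. -/
noncomputable def cutoff (ε a : ℝ) : ℝ := max 0 ((|a| - (1 - ε)) / ε)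

/-! ### Scalar estimates for truncation and cutoff -/

section Scalar

variable {ε a : ℝ}

lemma continuous_clamp : Continuous (clamp ε) := by unfold clamp; fun_prop

lemma continuous_cutoff : Continuous (cutoff ε) := by unfold cutoff; fun_prop

lemma clamp_zero : clamp ε 0 = 0 := by simp [clamp]

lemma cutoff_zero (h0 : 0 < ε) (h1 : ε < 1) : cutoff ε 0 = 0 := by
  simp only [cutoff, abs_zero, zero_sub]
  exact max_eq_left (div_nonpos_of_nonpos_of_nonneg (by linarith) h0.le)

lemma abs_clamp_le : |clamp ε a| ≤ 1 :=
  abs_le.2 ⟨le_max_left _ _, max_le (by norm_num) (min_le_left _ _)⟩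

lemma clamp_cases (h1 : ε < 1) :
    (1 - ε ≤ a ∧ clamp ε a = 1) ∨ (a ≤ -(1 - ε) ∧ clamp ε a = -1) ∨
      (|a| ≤ 1 - ε ∧ clamp ε a * (1 - ε) = a) := by
  have h : 0 < 1 - ε := by linarith
  unfold clamp
  rcases le_total (1 - ε) a with ha | ha
  · left
    rw [min_eq_left ((one_le_div h).2 ha)]
    exact ⟨ha, by norm_num⟩
  · rcases le_total a (-(1 - ε)) with hb | hb
    · right; left
      have : a / (1 - ε) ≤ -1 := by rw [div_le_iff₀ h]; linarith
      rw [min_eq_right (by linarith), max_eq_left this]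
      exact ⟨hb, rfl⟩
    · right; right
      have h2 : -1 ≤ a / (1 - ε) := by rw [le_div_iff₀ h]; linarith
      have h3 : a / (1 - ε) ≤ 1 := (div_le_one h).2 ha
      rw [min_eq_right h3, max_eq_right h2]
      exact ⟨abs_le.2 ⟨hb, ha⟩, div_mul_cancel₀ _ h.ne'⟩

lemma abs_sub_clamp_le (h0 : 0 < ε) (h1 : ε < 1) (ha : |a| ≤ 1) : |a - clamp ε a| ≤ ε := by
  have hc := abs_le.1 (abs_clamp_le (ε := ε) (a := a))
  rw [abs_le] at ha
  rcases clamp_cases (a := a) h1 with ⟨h, e⟩ | ⟨h, e⟩ | ⟨h, e⟩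
  · rw [e, abs_le]; constructor <;> linarith
  · rw [e, abs_le]; constructor <;> linarith
  · rw [abs_le]; constructor <;> nlinarith

/-- Testing a contraction on `2 • f₀ - f` will give `T f ≥ 2 * T f₀ - 1`, so truncation nearly
preserves large values. -/
lemma abs_two_mul_sub_clamp_le (h0 : 0 < ε) (h1 : ε < 1) (ha : |a| ≤ 1) :
    |2 * a - clamp ε a| ≤ 1 := by
  have hc := abs_le.1 (abs_clamp_le (ε := ε) (a := a))
  rw [abs_le] at ha
  rcases clamp_cases (a := a) h1 with ⟨h, e⟩ | ⟨h, e⟩ | ⟨h, e⟩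
  · rw [e, abs_le]; constructor <;> nlinarith
  · rw [e, abs_le]; constructor <;> nlinarith
  · rw [abs_le]; constructor <;> nlinarith

end Scalar

/-! ### Perturbing a contraction on `C₀(S, ℝ)` -/

section Operators

variable {S L : Type*} [TopologicalSpace S] [TopologicalSpace L]

/-- `φ` lives where `f = ±1`; where `φ < 1` the last bound leaves room to push `f₀` inside the unit
ball, so `T` has little mass there. -/
lemma exists_clamp_cutoff {ε : ℝ} (h0 : 0 < ε) (h1 : ε < 1) {f₀ : C₀(S, ℝ)}
    (hf₀ : ∀ x, |f₀ x| ≤ 1) :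
    ∃ f φ : C₀(S, ℝ), (∀ x, |f x| ≤ 1) ∧ (∀ x, |f₀ x - f x| ≤ ε) ∧
      (∀ x, |2 * f₀ x - f x| ≤ 1) ∧ (∀ x, 0 ≤ φ x ∧ φ x ≤ 1) ∧
      (∀ x, φ x * f x ^ 2 = φ x) ∧ ∀ x, |f₀ x| + ε * (1 - φ x) ≤ 1 := by
  refine ⟨postcomp (clamp ε) continuous_clamp clamp_zero f₀,
    postcomp (cutoff ε) continuous_cutoff (cutoff_zero h0 h1) f₀, fun x => abs_clamp_le,
    fun x => abs_sub_clamp_le h0 h1 (hf₀ x), fun x => abs_two_mul_sub_clamp_le h0 h1 (hf₀ x),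
    fun x => ⟨le_max_left _ _, ?_⟩, fun x => ?_, fun x => ?_⟩
  · refine max_le zero_le_one ((div_le_one h0).2 ?_)
    linarith [hf₀ x]
  · simp only [postcomp_apply]
    rcases clamp_cases (a := f₀ x) h1 with ⟨-, e⟩ | ⟨-, e⟩ | ⟨h, -⟩
    · rw [e]; ring
    · rw [e]; ring
    · have : cutoff ε (f₀ x) = 0 :=
        max_eq_left (div_nonpos_of_nonpos_of_nonneg (by linarith) h0.le)
      rw [this, zero_mul]
  · have h : (|f₀ x| - (1 - ε)) / ε ≤ cutoff ε (f₀ x) := le_max_right _ _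
    rw [div_le_iff₀ h0] at h
    simp only [postcomp_apply]
    linarith

lemma abs_apply_le_of_opNorm_le {T : C₀(S, ℝ) →L[ℝ] C₀(L, ℝ)} (hT : ‖T‖ ≤ 1) {u : C₀(S, ℝ)}
    (hu : ∀ x, |u x| ≤ 1) (t : L) : |T u t| ≤ 1 :=
  (abs_apply_le_norm _ t).trans <| (T.le_opNorm u).trans <|
    mul_le_one₀ hT (norm_nonneg _) ((norm_le_iff zero_le_one).2 hu)

lemma opNorm_le_of_forall_abs_apply_le {A : C₀(S, ℝ) →L[ℝ] C₀(L, ℝ)} {C : ℝ} (hC : 0 ≤ C)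
    (h : ∀ u : C₀(S, ℝ), (∀ x, |u x| ≤ 1) → ∀ t, |A u t| ≤ C) : ‖A‖ ≤ C :=
  ContinuousLinearMap.opNorm_le_of_unit_norm hC fun u hu =>
    (norm_le_iff hC).2 (h u ((norm_le_iff zero_le_one).1 hu.le))

/-- Near a point `t` where the norm of `v ↦ T (φ * v) t` is almost maximal over `U`, a weight `w`
isolates the part of `T` for which `f` is extremal. -/
lemma exists_weight {T : C₀(S, ℝ) →L[ℝ] C₀(L, ℝ)} (hT : ‖T‖ ≤ 1) {f φ : C₀(S, ℝ)}
    (hf : ∀ x, |f x| ≤ 1) (hφ : ∀ x, 0 ≤ φ x ∧ φ x ≤ 1) (hφf : ∀ x, φ x * f x ^ 2 = φ x)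
    {U : Set L} (hU : IsOpen U) (hne : U.Nonempty) {κ δ : ℝ} (hδ : 0 < δ)
    (hκ : ∀ t ∈ U, κ ≤ T (φ * f) t) :
    ∃ (w : C₀(S, ℝ)) (V : Set L) (t : L), IsOpen V ∧ t ∈ V ∧ (∀ x, 0 ≤ w x ∧ w x ≤ 1) ∧
      κ - δ ≤ T (w * f) t ∧ (∀ s ∈ V, T (w * f) t - δ ≤ T (w * f) s) ∧
      ∀ s ∈ V, ∀ u : C₀(S, ℝ), (∀ x, |u x| ≤ 1) → |T (w * u) s| ≤ T (w * f) t + δ := by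
  have hprod : ∀ v : C₀(S, ℝ), (∀ x, |v x| ≤ 1) → ∀ x, |(φ * v) x| ≤ 1 := fun v hv x => by
    rw [mul_apply, abs_mul, abs_of_nonneg (hφ x).1]
    exact mul_le_one₀ (hφ x).2 (abs_nonneg _) (hv x)
  set A : Set ℝ := {r | ∃ t ∈ U, ∃ v : C₀(S, ℝ), (∀ x, |v x| ≤ 1) ∧ T (φ * v) t = r}
  have hAne : A.Nonempty := hne.elim fun t ht => ⟨_, t, ht, f, hf, rfl⟩
  have hAb : BddAbove A := by
    refine ⟨1, ?_⟩
    rintro r ⟨t, -, v, hv, rfl⟩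
    exact (abs_le.1 (abs_apply_le_of_opNorm_le hT (hprod v hv) t)).2
  obtain ⟨_, ⟨t, ht, g, hg, rfl⟩, hlt⟩ := exists_lt_of_lt_csSup hAne
    (show sSup A - δ / 2 < sSup A by linarith)
  have hmax : ∀ s ∈ U, ∀ v : C₀(S, ℝ), (∀ x, |v x| ≤ 1) →
      T (φ * v) s ≤ T (φ * g) t + δ / 2 := fun s hs v hv => by
    linarith [le_csSup hAb ⟨s, hs, v, hv, rfl⟩]
  have hfg : ∀ x, |f x * g x| ≤ 1 := fun x => by
    rw [abs_mul]; exact mul_le_one₀ (hf x) (abs_nonneg _) (hg x)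
  -- `w = φ * (1 + f * g) / 2` keeps the part where the near-maximizer `g` agrees with `f`; `z`
  -- carries the disagreement, and `w * f + z = φ * g`.
  set w : C₀(S, ℝ) := (1 / 2 : ℝ) • (φ + φ * f * g) with hw
  set z : C₀(S, ℝ) := (1 / 2 : ℝ) • (φ * g - φ * f) with hz
  have hwf : w * f = (1 / 2 : ℝ) • (φ * f + φ * g) := by
    ext x
    simp only [hw, mul_apply, smul_apply, add_apply, smul_eq_mul]
    linear_combination (g x / 2) * hφf x
  have hTwf : ∀ s, T (w * f) s = 1 / 2 * (T (φ * f) s + T (φ * g) s) := fun s => by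
    rw [hwf, map_smul, map_add]; rfl
  have hTz : ∀ s, T z s = 1 / 2 * (T (φ * g) s - T (φ * f) s) := fun s => by
    rw [hz, map_smul, map_sub]; rfl
  have hone : ∀ s ∈ U ∩ {s | T z t - δ / 2 < T z s}, ∀ u : C₀(S, ℝ), (∀ x, |u x| ≤ 1) →
      T (w * u) s ≤ T (w * f) t + δ := by
    rintro s ⟨hs, hsz⟩ u hu
    -- A pointwise convex combination of `u` and `-f` with `φ * v = w * u + z`. Near-maximality
    -- bounds `T (φ * v) s`, and continuity of `T z` handles the rest.
    set v : C₀(S, ℝ) := (1 / 2 : ℝ) • (u + f * g * u - f + f * f * g) with hv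
    have hv1 : ∀ x, |v x| ≤ 1 := fun x => by
      have e : v x = (1 + f x * g x) / 2 * u x + (1 - f x * g x) / 2 * (-f x) := by
        simp only [hv, mul_apply, smul_apply, add_apply, sub_apply, smul_eq_mul]
        ring
      have h1 := abs_le.1 (hfg x)
      have h2 := abs_le.1 (hu x)
      have h3 := abs_le.1 (hf x)
      rw [e, abs_le]
      constructor <;> nlinarith
    have e : φ * v = w * u + z := by
      ext x
      simp only [hv, hw, hz, mul_apply, smul_apply, add_apply, sub_apply, smul_eq_mul]
      linear_combination (g x / 2) * hφf x
    have h := hmax s hs v hv1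
    rw [e, map_add, add_apply] at h
    have hsz' : T z t - δ / 2 < T z s := hsz
    rw [hTz t] at hsz'
    rw [hTwf t]
    linarith
  refine ⟨w, U ∩ {s | T z t - δ / 2 < T z s} ∩ {s | T (w * f) t - δ < T (w * f) s}, t,
    (hU.inter (isOpen_lt continuous_const (map_continuous (T z)))).inter
      (isOpen_lt continuous_const (map_continuous (T (w * f)))),
    ⟨⟨ht, ?_⟩, ?_⟩, fun x => ?_, ?_, fun s hs => hs.2.le, fun s hs u hu => abs_le'.2 ⟨?_, ?_⟩⟩
  · change T z t - δ / 2 < T z t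
    linarith
  · change T (w * f) t - δ < T (w * f) t
    linarith
  · have e : w x = φ x * ((1 + f x * g x) / 2) := by
      simp only [hw, mul_apply, smul_apply, add_apply, smul_eq_mul]
      ring
    have h1 := abs_le.1 (hfg x)
    rw [e]
    exact ⟨mul_nonneg (hφ x).1 (by linarith),
      mul_le_one₀ (hφ x).2 (by linarith) (by linarith)⟩
  · have h1 := hmax t ht f hf
    have h2 := hκ t ht
    rw [hTwf t]
    linarith
  · exact hone s hs.1 u hu
  · have h := hone s hs.1 (-u) fun x => by simpa using hu x
    have e : w * -u = -(w * u) := by ext x; simp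
    rwa [e, map_neg, neg_apply] at h

/-- A contraction that almost attains its norm at `f₀`, where its value is almost `1` at a point,
can be perturbed so as to attain its norm up to an arbitrarily small error near `f₀`. -/
lemma exists_perturbation_of_lt_apply [LocallyCompactSpace L] [T2Space L] {ε : ℝ} (h0 : 0 < ε)
    (h1 : ε < 1) {T : C₀(S, ℝ) →L[ℝ] C₀(L, ℝ)} (hT : ‖T‖ ≤ 1) {f₀ : C₀(S, ℝ)} (hf₀ : ‖f₀‖ ≤ 1)
    {t₀ : L} (ht₀ : 1 - ε ^ 2 / 20 < T f₀ t₀) {γ : ℝ} (hγ : 0 < γ) :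
    ∃ (R : C₀(S, ℝ) →L[ℝ] C₀(L, ℝ)) (f : C₀(S, ℝ)), ‖R‖ ≤ 1 ∧ ‖f‖ ≤ 1 ∧ 1 - γ ≤ ‖R f‖ ∧
      ‖f₀ - f‖ ≤ ε ∧ ‖T - R‖ ≤ ε := by
  obtain ⟨f, φ, hf, hf₀f, h2f, hφ, hφf, hfφ⟩ :=
    exists_clamp_cutoff h0 h1 ((norm_le_iff zero_le_one).1 hf₀)
  set U : Set L := {t | 1 - ε ^ 2 / 20 < T f₀ t}
  have hU : IsOpen U := isOpen_lt continuous_const (map_continuous (T f₀))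
  have hκ : ∀ t ∈ U, 1 - 3 * ε / 20 ≤ T (φ * f) t := by
    intro t ht
    have ht' : 1 - ε ^ 2 / 20 < T f₀ t := ht
    have a1 : T ((2 : ℝ) • f₀ - f) t ≤ 1 :=
      (abs_le.1 (abs_apply_le_of_opNorm_le hT (u := (2 : ℝ) • f₀ - f) h2f t)).2
    have a2 : T (f₀ + ε • (f - φ * f)) t ≤ 1 := by
      refine (abs_le.1 (abs_apply_le_of_opNorm_le hT (fun x => ?_) t)).2
      have e : (f₀ + ε • (f - φ * f)) x = f₀ x + ε * (1 - φ x) * f x := by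
        simp only [mul_apply, smul_apply, add_apply, sub_apply, smul_eq_mul]
        ring
      have hn : 0 ≤ ε * (1 - φ x) := mul_nonneg h0.le (by linarith [(hφ x).2])
      rw [e]
      refine (abs_add_le _ _).trans ((add_le_add_right ?_ _).trans (hfφ x))
      rw [abs_mul, abs_of_nonneg hn]
      exact mul_le_of_le_one_right hn (hf x)
    simp only [map_add, map_sub, map_smul, smul_apply, add_apply, sub_apply, smul_eq_mul]
      at a1 a2
    have a3 : T f t - T (φ * f) t ≤ ε / 20 := by
      by_contra! hc
      nlinarith
    nlinarith
  -- `γ / 4` controls the attainment defect `c * δ ≤ 2 * δ`; `ε / 40` keeps `1 - k + δ ≤ ε / 5`.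
  set δ : ℝ := min (γ / 4) (ε / 40)
  have hδ0 : 0 < δ := by positivity
  have hδγ : δ ≤ γ / 4 := min_le_left _ _
  have hδε : δ ≤ ε / 40 := min_le_right _ _
  obtain ⟨w, V, t, hV, htV, hw, hk, hwV, huV⟩ := exists_weight hT hf hφ hφf hU ⟨t₀, ht₀⟩ hδ0 hκ
  obtain ⟨h, ht1, hV0, hI⟩ := exists_bump hV htV
  have hmul : ∀ a b : ℝ, 0 ≤ a ∧ a ≤ 1 → |b| ≤ 1 → |a * b| ≤ 1 := fun a b ha hb => by
    rw [abs_mul, abs_of_nonneg ha.1]; exact mul_le_one₀ ha.2 (abs_nonneg _) hb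
  set k := T (w * f) t
  have hk1 : k ≤ 1 := (abs_le.1 (abs_apply_le_of_opNorm_le hT (u := w * f)
    (fun x => hmul _ _ (hw x) (hf x)) t)).2
  have hkδ : 0 < k + δ := by linarith
  set c := (k + δ)⁻¹
  have hck : c * (k + δ) = 1 := inv_mul_cancel₀ hkδ.ne'
  have hc0 : 0 < c := inv_pos.2 hkδ
  let P : C₀(S, ℝ) →L[ℝ] C₀(L, ℝ) := c • T ∘L ContinuousLinearMap.mul ℝ C₀(S, ℝ) w
  let D : C₀(S, ℝ) →L[ℝ] C₀(L, ℝ) := ContinuousLinearMap.mul ℝ C₀(L, ℝ) h ∘L (T - P)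
  have hD : ∀ u s, D u s = h s * (T u s - c * T (w * u) s) := fun u s => rfl
  have hP : ∀ u : C₀(S, ℝ), (∀ x, |u x| ≤ 1) → ∀ s ∈ V, |c * T (w * u) s| ≤ 1 := by
    intro u hu s hs
    rw [abs_mul, abs_of_pos hc0, ← hck]
    exact mul_le_mul_of_nonneg_left (huV s hs u hu) hc0.le
  have hR : ‖T - D‖ ≤ 1 := by
    refine opNorm_le_of_forall_abs_apply_le zero_le_one fun u hu s => ?_
    have e : (T - D) u s = (1 - h s) * T u s + h s * (c * T (w * u) s) := by
      change T u s - D u s = _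
      rw [hD]; ring
    have b1 := abs_le.1 (abs_apply_le_of_opNorm_le hT hu s)
    rw [e]
    by_cases hs : s ∈ V
    · have b2 := abs_le.1 (hP u hu s hs)
      have b3 := hI s
      rw [abs_le]
      constructor <;> nlinarith
    · rw [hV0 s hs, abs_le]
      constructor <;> linarith
  refine ⟨T - D, f, hR, (norm_le_iff zero_le_one).2 hf, ?_, (norm_le_iff h0.le).2 hf₀f, ?_⟩
  · have e : (T - D) f t = c * k := by
      change T f t - D f t = _
      rw [hD, ht1]; ring
    have b1 : (T - D) f t ≤ ‖(T - D) f‖ := (le_abs_self _).trans (abs_apply_le_norm _ t)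
    have b2 : c ≤ 2 := by
      by_contra! hc2
      nlinarith
    rw [e] at b1
    nlinarith
  · have e : T - (T - D) = D := by
      ext u s
      change T u s - (T u s - D u s) = _
      ring
    rw [e]
    refine opNorm_le_of_forall_abs_apply_le h0.le fun u hu s => ?_
    rw [hD, abs_mul, abs_of_nonneg (hI s).1]
    by_cases hs : s ∈ V
    -- The test function is a convex combination of `f` and `r • u` with weight `w`; as `T (w * f)
    -- s` is almost `1`, little mass is left for `u - w * u`.
    · have hsplit : ∀ r : ℝ, |r| ≤ 1 → T (w * f) s + r * (T u s - T (w * u) s) ≤ 1 := by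
        intro r hr
        have b := (abs_le.1 (abs_apply_le_of_opNorm_le hT (u := w * f + r • (u - w * u))
          (fun x => ?_) s)).2
        · simpa only [map_add, map_sub, map_smul, smul_apply, add_apply, sub_apply, smul_eq_mul]
            using b
        · have e : (w * f + r • (u - w * u)) x = w x * f x + (1 - w x) * (r * u x) := by
            simp only [mul_apply, smul_apply, add_apply, sub_apply, smul_eq_mul]
            ring
          have b1 := abs_le.1 (hf x)
          have b2 : |r * u x| ≤ 1 := by
            rw [abs_mul]; exact mul_le_one₀ hr (abs_nonneg _) (hu x)
          rw [abs_le] at b2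
          have b3 := hw x
          rw [e, abs_le]
          constructor <;> nlinarith
      have b1 := hsplit 1 (by simp)
      have b2 := hsplit (-1) (by simp)
      have b3 := hwV s hs
      have b4 : |T u s - T (w * u) s| ≤ 1 - k + δ := abs_le.2 ⟨by linarith, by linarith⟩
      have b5 : |(1 - c) * T (w * u) s| ≤ 1 - k + δ := by
        have e : (1 - c) * T (w * u) s = (k + δ - 1) * (c * T (w * u) s) := by
          linear_combination (-T (w * u) s) * hck
        rw [e, abs_mul]
        refine (mul_le_of_le_one_right (abs_nonneg _) (hP u hu s hs)).trans ?_
        rw [abs_le]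
        constructor <;> linarith
      have e : T u s - c * T (w * u) s = (T u s - T (w * u) s) + (1 - c) * T (w * u) s := by ring
      have b6 : |T u s - c * T (w * u) s| ≤ ε := by
        rw [e]
        refine (abs_add_le _ _).trans ?_
        linarith
      exact (mul_le_of_le_one_left (abs_nonneg _) (hI s).2).trans b6
    · rw [hV0 s hs, zero_mul]
      exact h0.le

lemma exists_perturbation [LocallyCompactSpace L] [T2Space L] {ε : ℝ} (h0 : 0 < ε)
    (h1 : ε < 1) {T : C₀(S, ℝ) →L[ℝ] C₀(L, ℝ)} (hT : ‖T‖ ≤ 1) {f₀ : C₀(S, ℝ)} (hf₀ : ‖f₀‖ ≤ 1)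
    (hTf : 1 - ε ^ 2 / 20 < ‖T f₀‖) {γ : ℝ} (hγ : 0 < γ) :
    ∃ (R : C₀(S, ℝ) →L[ℝ] C₀(L, ℝ)) (f : C₀(S, ℝ)), ‖R‖ ≤ 1 ∧ ‖f‖ ≤ 1 ∧ 1 - γ ≤ ‖R f‖ ∧
      ‖f₀ - f‖ ≤ ε ∧ ‖T - R‖ ≤ ε := by
  obtain ⟨t, ht⟩ : ∃ t, 1 - ε ^ 2 / 20 < |T f₀ t| := by
    by_contra! hc
    exact absurd ((norm_le_iff (by nlinarith)).2 hc) (not_le.2 hTf)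
  rcases lt_abs.1 ht with ht | ht
  · exact exists_perturbation_of_lt_apply h0 h1 hT hf₀ ht hγ
  · obtain ⟨R, f, hR, hf, hRf, hff, hTR⟩ := exists_perturbation_of_lt_apply h0 h1 hT
      (f₀ := -f₀) (by rwa [norm_neg]) (t₀ := t) (by rwa [map_neg, neg_apply]) hγ
    refine ⟨R, -f, hR, by rwa [norm_neg], by rwa [map_neg, norm_neg], ?_, hTR⟩
    have e : f₀ - -f = -(-f₀ - f) := by abel
    rwa [e, norm_neg]

end Operators

end ZeroAtInftyContinuousMap

/-- If contractions almost attaining their norm can be perturbed, with a quadratic modulus, so as to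
attain it up to an arbitrarily small error, then the pair has the Bishop–Phelps–Bollobás
property. -/
lemma HasBPBp.of_exists_perturbation {𝕜 X Y : Type*} [RCLike 𝕜]
    [NormedAddCommGroup X] [NormedSpace 𝕜 X] [CompleteSpace X]
    [NormedAddCommGroup Y] [NormedSpace 𝕜 Y] [CompleteSpace Y] {η : ℝ → ℝ}
    (hη : ∀ ε, 0 < ε → 0 < η ε)
    (H : ∀ ε : ℝ, 0 < ε → ε < 1 → ∀ (T : X →L[𝕜] Y) (x₀ : X), ‖T‖ ≤ 1 → ‖x₀‖ ≤ 1 →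
      1 - η ε < ‖T x₀‖ → ∀ γ : ℝ, 0 < γ → ∃ (R : X →L[𝕜] Y) (x : X), ‖R‖ ≤ 1 ∧ ‖x‖ ≤ 1 ∧
        1 - γ ≤ ‖R x‖ ∧ ‖x₀ - x‖ ≤ ε ∧ ‖T - R‖ ≤ ε) :
    HasBPBp 𝕜 X Y := by
  intro ε h0 h1
  -- The steps sum to `ε / 2`, which makes the final estimates strict.
  let e : ℕ → ℝ := fun n => ε / 2 / 2 / 2 ^ n
  have he0 : ∀ n, 0 < e n := fun n => by positivity
  have he1 : ∀ n, e n < 1 := fun n => by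
    have : e n ≤ ε / 2 / 2 := div_le_self (by positivity) (one_le_pow₀ (by norm_num))
    linarith
  -- `η (e n)` permits the next step; `e n` forces the defect to `0`.
  let θ : ℕ → ℝ := fun n => min (η (e n)) (e n)
  have hθ0 : ∀ n, 0 < θ n := fun n => lt_min (hη _ (he0 n)) (he0 n)
  refine ⟨θ 0, hθ0 0, fun T x₀ hT hx₀ hTx => ?_⟩
  let G : ℕ → Type _ := fun n =>
    {p : (X →L[𝕜] Y) × X // ‖p.1‖ ≤ 1 ∧ ‖p.2‖ ≤ 1 ∧ 1 - θ n < ‖p.1 p.2‖}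
  have hstep : ∀ n (p : G n), ∃ q : G (n + 1), dist p.1 q.1 ≤ e n := by
    rintro n ⟨⟨A, a⟩, hA, ha, hAa⟩
    obtain ⟨R, x, hR, hx, hRx, hax, hAR⟩ := H (e n) (he0 n) (he1 n) A a hA ha
      ((sub_le_sub_left (min_le_left _ _) _).trans_lt hAa) (θ (n + 1) / 2) (half_pos (hθ0 _))
    refine ⟨⟨(R, x), hR, hx, ?_⟩, ?_⟩
    · have := hθ0 (n + 1)
      change 1 - θ (n + 1) < ‖R x‖
      linarith
    · rw [Prod.dist_eq, dist_eq_norm, dist_eq_norm]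
      exact max_le hAR hax
  choose F hF using hstep
  let q : ∀ n, G n := fun n => Nat.rec ⟨(T, x₀), hT.le, hx₀.le, hTx⟩ F n
  let p : ℕ → (X →L[𝕜] Y) × X := fun n => (q n).1
  have hp : ∀ n, dist (p n) (p (n + 1)) ≤ ε / 2 / 2 / 2 ^ n := fun n => hF n (q n)
  obtain ⟨⟨R, x⟩, hlim⟩ := cauchySeq_tendsto_of_complete (cauchySeq_of_le_geometric_two hp)
  have hdist : dist (p 0) (R, x) ≤ ε / 2 := dist_le_of_le_geometric_two_of_tendsto₀ hp hlim
  rw [Prod.dist_eq, dist_eq_norm, dist_eq_norm] at hdist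
  have hlim1 : Filter.Tendsto (fun n => (p n).1) Filter.atTop (nhds R) :=
    (continuous_fst.tendsto _).comp hlim
  have hlim2 : Filter.Tendsto (fun n => (p n).2) Filter.atTop (nhds x) :=
    (continuous_snd.tendsto _).comp hlim
  have hR : ‖R‖ ≤ 1 := le_of_tendsto' hlim1.norm fun n => (q n).2.1
  have hx : ‖x‖ ≤ 1 := le_of_tendsto' hlim2.norm fun n => (q n).2.2.1
  have he : Filter.Tendsto (fun n => 1 - e n) Filter.atTop (nhds 1) := by
    simpa using (summable_geometric_two' (ε / 2)).tendsto_atTop_zero.const_sub 1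
  have hRlim : Filter.Tendsto (fun n => (p n).1 (p n).2) Filter.atTop (nhds (R x)) :=
    (isBoundedBilinearMap_apply.continuous.tendsto (R, x)).comp hlim
  have hRx : 1 ≤ ‖R x‖ := le_of_tendsto_of_tendsto' he hRlim.norm fun n =>
    (sub_le_sub_left (min_le_right _ _) _).trans (q n).2.2.2.le
  have hle := R.le_opNorm x
  have hx0 := norm_nonneg x
  have hR0 := norm_nonneg R
  refine ⟨R, x, ?_, ?_, ?_, ?_, ?_⟩
  · nlinarith
  · nlinarith
  · nlinarith
  · exact ((le_max_right _ _).trans hdist).trans_lt (by linarith)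
  · exact ((le_max_left _ _).trans hdist).trans_lt (by linarith)

theorem mainTheorem4 {S L : Type*}
    [TopologicalSpace S] [LocallyCompactSpace S] [TopologicalSpace.MetrizableSpace S]
    [TopologicalSpace L] [LocallyCompactSpace L] [T2Space L] :
    HasBPBp ℝ C₀(S, ℝ) C₀(L, ℝ) :=
  HasBPBp.of_exists_perturbation (η := fun ε => ε ^ 2 / 20) (fun ε h => by positivity)
    fun _ h0 h1 _ _ hT hf hTf _ hγ =>
      ZeroAtInftyContinuousMap.exists_perturbation h0 h1 hT hf hTf hγ
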